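/- Let $\mathbb D=\{z\in\mathbb C:|z|<1\}$. Let $v:[0,1)\to(0,\infty)$ be continuous and increasing (not necessarily strictly) with $\lim_{r\to1^-}v(r)=\infty$, let $v$ be log-convex, i.e. the function $x\mapsto\log v(e^x)$ is convex on $(-\infty,0)$, and put $w(r)=v(r)/(1-r)$ for $r\in[0,1)$. For $u\in\{v,w\}$ let $H_u(\mathbb D)$ be the space of all holomorphic functions $f$ on $\mathbb D$ with $$\|f\|_u:=\sup_{z\in\mathbb D}\frac{|f(z)|}{u(|z|)}<\infty,$$ endowed with the norm $\|\cdot\|_u$. Then the differentiation operator $D:f\mapsto f'$ is an epimorphism from $H_v(\mathbb D)$ to $H_w(\mathbb D)$ (that is, $D$ maps $H_v(\mathbb D)$ into $H_w(\mathbb D)$, and $D:H_v(\mathbb D)\to H_w(\mathbb D)$ is continuous and surjective) if and only if $$0<\liminf_{r\to1^-}\frac{(1-r)v'(r)}{v(r)}\le\limsup_{r\to1^-}\frac{(1-r)v'(r)}{v(r)}<\infty,$$ where $v'$ denotes the right derivative of $v$, which exists on $(0,1)$ by log-convexity. -/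

import Mathlib

open Set Filter Topology

noncomputable section

/-- A weight on an open set `G ⊆ ℂ`: a positive continuous function on `G`. -/
structure Weight (G : TopologicalSpace.Opens ℂ) where
  toFun : G → ℝ
  pos : ∀ z, 0 < toFun z
  continuous : Continuous toFun

/-- Extension by zero of a function on `G` to all of `ℂ`. -/
def zeroExtend {G : TopologicalSpace.Opens ℂ} (f : G → ℂ) : ℂ → ℂ :=
  Function.extend Subtype.val f 0

/-- `f` is holomorphic on the open set `G`. -/
def IsHolomorphic {G : TopologicalSpace.Opens ℂ} (f : G → ℂ) : Prop :=
  DifferentiableOn ℂ (zeroExtend f) (G : Set ℂ)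

/-- The derivative `f'` of a function `f` on `G`. -/
def complexDeriv {G : TopologicalSpace.Opens ℂ} (f : G → ℂ) : G → ℂ :=
  fun z => deriv (zeroExtend f) (z : ℂ)

theorem zeroExtend_add {G : TopologicalSpace.Opens ℂ} (f g : G → ℂ) :
    zeroExtend (f + g) = zeroExtend f + zeroExtend g := by
  have h := Function.extend_add (Subtype.val : G → ℂ) f g (0 : ℂ → ℂ) 0
  simpa [zeroExtend] using h

theorem zeroExtend_smul {G : TopologicalSpace.Opens ℂ} (c : ℂ) (f : G → ℂ) :
    zeroExtend (c • f) = c • zeroExtend f := by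
  have h := Function.extend_smul c (Subtype.val : G → ℂ) f (0 : ℂ → ℂ)
  simpa [zeroExtend] using h

/-- The vector space of all holomorphic `f` on `G` with `sup_{z ∈ G} |f(z)| / v(z) < ∞`. -/
def weightedSubmodule {G : TopologicalSpace.Opens ℂ} (v : Weight G) :
    Submodule ℂ (G → ℂ) where
  carrier := {f | IsHolomorphic f ∧ BddAbove (range fun z => ‖f z‖ / v.toFun z)}
  zero_mem' := by
    refine ⟨?_, 0, ?_⟩
    · have h : zeroExtend (0 : G → ℂ) = 0 := by
        simpa using zeroExtend_smul (0 : ℂ) (0 : G → ℂ)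
      unfold IsHolomorphic
      rw [h]
      exact differentiableOn_const 0
    · rintro _ ⟨z, rfl⟩
      simp
  add_mem' := by
    rintro f g ⟨hf, A, hA⟩ ⟨hg, B, hB⟩
    refine ⟨?_, A + B, ?_⟩
    · unfold IsHolomorphic
      rw [zeroExtend_add]
      exact hf.add hg
    · rintro _ ⟨z, rfl⟩
      have h1 := hA ⟨z, rfl⟩
      have h2 := hB ⟨z, rfl⟩
      have h3 := div_le_div_of_nonneg_right (norm_add_le (f z) (g z)) (v.pos z).le
      simp only [Pi.add_apply] at *
      rw [add_div] at h3
      linarith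
  smul_mem' := by
    rintro c f ⟨hf, A, hA⟩
    refine ⟨?_, ‖c‖ * A, ?_⟩
    · unfold IsHolomorphic
      rw [zeroExtend_smul]
      exact hf.const_smul c
    · rintro _ ⟨z, rfl⟩
      have h1 := mul_le_mul_of_nonneg_left (hA ⟨z, rfl⟩) (norm_nonneg c)
      simpa [mul_div_assoc] using h1

/-- The space `H_v(G)`. It is a separate type so that its only topology is that of `‖·‖_v`,
and not pointwise convergence. -/
def WeightedSpace {G : TopologicalSpace.Opens ℂ} (v : Weight G) : Type :=
  weightedSubmodule v

namespace WeightedSpace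

variable {G : TopologicalSpace.Opens ℂ} {v : Weight G}

instance : AddCommGroup (WeightedSpace v) :=
  inferInstanceAs (AddCommGroup (weightedSubmodule v))

instance : Module ℂ (WeightedSpace v) :=
  inferInstanceAs (Module ℂ (weightedSubmodule v))

/-- The underlying function on `G`. -/
def fn (f : WeightedSpace v) : G → ℂ := f.1

/-- `‖f‖_v = sup_{z ∈ G} |f(z)| / v(z)`. -/
instance : Norm (WeightedSpace v) where
  norm f := ⨆ z : G, ‖f.fn z‖ / v.toFun z

theorem norm_def (f : WeightedSpace v) : ‖f‖ = ⨆ z : G, ‖f.fn z‖ / v.toFun z := rfl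

theorem fn_add (f g : WeightedSpace v) : (f + g).fn = f.fn + g.fn := rfl

theorem fn_smul (c : ℂ) (f : WeightedSpace v) : (c • f).fn = c • f.fn := rfl

theorem bdd (f : WeightedSpace v) : BddAbove (range fun z => ‖f.fn z‖ / v.toFun z) := f.2.2

theorem core : NormedSpace.Core ℂ (WeightedSpace v) where
  norm_nonneg f := Real.iSup_nonneg fun z => div_nonneg (norm_nonneg _) (v.pos z).le
  norm_smul c f := by
    rw [norm_def, norm_def, Real.mul_iSup_of_nonneg (norm_nonneg c)]
    simp [fn_smul, mul_div_assoc]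
  norm_triangle f g := by
    have hn : ∀ h : WeightedSpace v, 0 ≤ ‖h‖ := fun h =>
      Real.iSup_nonneg fun z => div_nonneg (norm_nonneg _) (v.pos z).le
    refine Real.iSup_le (fun z => ?_) (add_nonneg (hn f) (hn g))
    have h1 : ‖f.fn z‖ / v.toFun z ≤ ‖f‖ := le_ciSup f.bdd z
    have h2 : ‖g.fn z‖ / v.toFun z ≤ ‖g‖ := le_ciSup g.bdd z
    have h3 := div_le_div_of_nonneg_right (norm_add_le (f.fn z) (g.fn z)) (v.pos z).le
    rw [add_div] at h3
    rw [fn_add, Pi.add_apply]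
    linarith
  norm_eq_zero_iff f := by
    constructor
    · intro h
      refine Subtype.ext (funext fun z => ?_)
      have h1 : ‖f.fn z‖ / v.toFun z ≤ ‖f‖ := le_ciSup f.bdd z
      rw [h, div_le_iff₀ (v.pos z), zero_mul] at h1
      exact norm_le_zero_iff.mp h1
    · rintro rfl
      have : ∀ z, (0 : WeightedSpace v).fn z = 0 := fun _ => rfl
      simp [norm_def, this]

instance : NormedAddCommGroup (WeightedSpace v) := NormedAddCommGroup.ofCore core

instance : NormedSpace ℂ (WeightedSpace v) := NormedSpace.ofCore core

end WeightedSpace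

/-- The differentiation operator `D : f ↦ f'` is an epimorphism from `H_v(G)` to `H_w(G)`: it maps
`H_v(G)` into `H_w(G)`, is linear and continuous for the norms, and is onto. -/
def DiffIsEpimorphism {G : TopologicalSpace.Opens ℂ} (v w : Weight G) : Prop :=
  ∃ D : WeightedSpace v →L[ℂ] WeightedSpace w,
    (∀ f, (D f).fn = complexDeriv f.fn) ∧ Function.Surjective D

/-- The open unit disc. -/
def unitDisc : TopologicalSpace.Opens ℂ := ⟨Metric.ball 0 1, Metric.isOpen_ball⟩

/-- `v : [0,1) → (0,∞)` is the profile of a radial weight on the unit disc (the values of `v`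
outside `[0,1)` are irrelevant). -/
structure IsRadialDiscWeight (v : ℝ → ℝ) : Prop where
  pos : ∀ r ∈ Ico (0 : ℝ) 1, 0 < v r
  continuousOn : ContinuousOn v (Ico 0 1)
  monotoneOn : MonotoneOn v (Ico 0 1)
  tendsto : Tendsto v (𝓝[<] 1) atTop

theorem norm_mem_Ico_of_mem_unitDisc (z : unitDisc) : ‖(z : ℂ)‖ ∈ Ico (0 : ℝ) 1 :=
  ⟨norm_nonneg _, mem_ball_zero_iff.mp z.2⟩

/-- The weight `z ↦ v(|z|)` on the unit disc. -/
def IsRadialDiscWeight.toWeight {v : ℝ → ℝ} (hv : IsRadialDiscWeight v) : Weight unitDisc where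
  toFun z := v ‖(z : ℂ)‖
  pos z := hv.pos _ (norm_mem_Ico_of_mem_unitDisc z)
  continuous := hv.continuousOn.comp_continuous (continuous_norm.comp continuous_subtype_val)
    norm_mem_Ico_of_mem_unitDisc

/-- If `v` is a radial weight on the disc, then so is `w(r) = v(r) / (1 - r)`. -/
theorem IsRadialDiscWeight.div_one_sub {v : ℝ → ℝ} (hv : IsRadialDiscWeight v) :
    IsRadialDiscWeight fun r => v r / (1 - r) where
  pos r hr := div_pos (hv.pos r hr) (sub_pos.mpr hr.2)
  continuousOn := hv.continuousOn.div (by fun_prop) fun r hr => (sub_pos.mpr hr.2).ne'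
  monotoneOn r hr s hs h :=
    div_le_div₀ (hv.pos s hs).le (hv.monotoneOn hr hs h) (sub_pos.mpr hs.2) (by linarith)
  tendsto := by
    refine tendsto_atTop_mono' _ ?_ hv.tendsto
    filter_upwards [Ioo_mem_nhdsLT (zero_lt_one' ℝ)] with r hr
    rw [le_div_iff₀ (sub_pos.mpr hr.2)]
    have := hv.pos r ⟨hr.1.le, hr.2⟩
    nlinarith [hr.1]

/-- `v` is log-convex on `[0,1)`: the function `x ↦ log v(eˣ)` is convex on `(-∞, 0)`. -/
def IsLogConvexDisc (v : ℝ → ℝ) : Prop :=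
  ConvexOn ℝ (Iio 0) fun x => Real.log (v (Real.exp x))

/-- The right derivative of `v` at `r`. -/
def rightDeriv (v : ℝ → ℝ) (r : ℝ) : ℝ := derivWithin v (Ici r) r

/-- The quantity `(1 - r) v'(r) / v(r)`, as an extended real number, where `v'` is the right
derivative. -/
def growthQuotient (v : ℝ → ℝ) (r : ℝ) : EReal :=
  (((1 - r) * rightDeriv v r / v r : ℝ) : EReal)

end

/-! Let p(r) = r v'(r)/v(r), the right slope of φ(x) = log v(eˣ) at x = log r. Convexity puts φ
above its right tangents: v(s) ≥ v(r)(s/r)^{p(r)} for all s in (0,1). Near 1 the growth quotient is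
comparable to (1-r)p(r).

Sufficiency. An upper bound makes v doubling (`exists_doubling`), so Cauchy's estimate on discs of
radius (1-r)/2 bounds D. A lower bound c gives v/(1-r) ≤ v'/c, so integrating g along radii gives a
primitive bounded by a constant plus (‖g‖/c)v (`exists_primitive`).

Necessity. For the upper bound, test D on zⁿ with n = ⌊p(r)⌋: the tangent inequality forces sⁿ/v(s)
to peak at some s ≤ r, and there boundedness reads n(1-s) ≤ ‖D‖s. For the lower bound, the open
mapping theorem gives preimages with norm control. With 2^N ≥ p(r), the polynomial v(r) Σ
z^(4·2^(N+i)) has a derivative bounded in H_w independently of the number of terms, so its own size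
at r is bounded. If (1-r)p(r) were tiny, arbitrarily many terms would be at least v(r)/2 there. -/

/-! ### Restrictions to G, and completeness of the weighted spaces. -/

theorem zeroExtend_apply {G : TopologicalSpace.Opens ℂ} (f : G → ℂ) (z : G) :
    zeroExtend f z = f z :=
  Subtype.val_injective.extend_apply f 0 z

theorem zeroExtend_restrict_eqOn {G : TopologicalSpace.Opens ℂ} (F : ℂ → ℂ) :
    EqOn (zeroExtend fun z : G => F z) F G := fun z hz =>
  zeroExtend_apply (fun z : G => F z) ⟨z, hz⟩

theorem isHolomorphic_restrict {G : TopologicalSpace.Opens ℂ} {F : ℂ → ℂ}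
    (hF : DifferentiableOn ℂ F G) : IsHolomorphic fun z : G => F z :=
  hF.congr (zeroExtend_restrict_eqOn F)

theorem complexDeriv_restrict {G : TopologicalSpace.Opens ℂ} (F : ℂ → ℂ) :
    complexDeriv (fun z : G => F z) = fun z : G => deriv F z :=
  funext fun z => ((zeroExtend_restrict_eqOn F).eventuallyEq_of_mem (G.isOpen.mem_nhds z.2)).deriv_eq

namespace WeightedSpace

variable {G : TopologicalSpace.Opens ℂ} {v : Weight G}

/-- The element of `H_v(G)` given by a function that is holomorphic on `G` and bounded by a
multiple of the weight. -/
def ofBound (F : ℂ → ℂ) (hF : DifferentiableOn ℂ F G) (C : ℝ)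
    (hC : ∀ z : G, ‖F z‖ ≤ C * v.toFun z) : WeightedSpace v :=
  ⟨fun z => F z, isHolomorphic_restrict hF, C, by
    rintro _ ⟨z, rfl⟩
    exact (div_le_iff₀ (v.pos z)).mpr (hC z)⟩

theorem fn_ofBound {F : ℂ → ℂ} {hF : DifferentiableOn ℂ F G} {C : ℝ}
    {hC : ∀ z : G, ‖F z‖ ≤ C * v.toFun z} : (ofBound F hF C hC).fn = fun z : G => F z := rfl

theorem fn_injective : Function.Injective (fn : WeightedSpace v → G → ℂ) :=
  Subtype.val_injective

theorem norm_fn_le (f : WeightedSpace v) (z : G) : ‖f.fn z‖ ≤ ‖f‖ * v.toFun z :=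
  (div_le_iff₀ (v.pos z)).mp (le_ciSup f.bdd z)

theorem norm_le_of_forall (f : WeightedSpace v) {C : ℝ} (hC0 : 0 ≤ C)
    (hC : ∀ z : G, ‖f.fn z‖ ≤ C * v.toFun z) : ‖f‖ ≤ C :=
  Real.iSup_le (fun z => (div_le_iff₀ (v.pos z)).mpr (hC z)) hC0

theorem fn_sub (f g : WeightedSpace v) : (f - g).fn = f.fn - g.fn := rfl

theorem differentiableOn (f : WeightedSpace v) : DifferentiableOn ℂ (zeroExtend f.fn) G := f.2.1

/-- Completeness is what the open mapping theorem needs. The weight is locally bounded, so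
convergence in the weighted norm is locally uniform and the limit stays holomorphic. -/
instance : CompleteSpace (WeightedSpace v) := by
  refine Metric.complete_of_cauchySeq_tendsto fun u hu => ?_
  have key : ∀ ε > 0, ∃ N, ∀ m ≥ N, ∀ n ≥ N, ∀ z,
      ‖(u m).fn z - (u n).fn z‖ ≤ ε * v.toFun z := by
    intro ε hε
    obtain ⟨N, hN⟩ := Metric.cauchySeq_iff.mp hu ε hε
    refine ⟨N, fun m hm n hn z => ?_⟩
    have h1 := (u m - u n).norm_fn_le z
    have h2 := hN m hm n hn
    rw [dist_eq_norm] at h2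
    exact h1.trans (mul_le_mul_of_nonneg_right h2.le (v.pos z).le)
  have hlim : ∀ z, ∃ a, Tendsto (fun n => (u n).fn z) atTop (𝓝 a) := by
    intro z
    refine cauchySeq_tendsto_of_complete (Metric.cauchySeq_iff.mpr fun ε hε => ?_)
    have hv := v.pos z
    obtain ⟨N, hN⟩ := key (ε / 2 / v.toFun z) (by positivity)
    refine ⟨N, fun m hm n hn => ?_⟩
    have := hN m hm n hn z
    rw [div_mul_cancel₀ _ hv.ne'] at this
    rw [dist_eq_norm]
    linarith
  choose f hf using hlim
  have key2 : ∀ ε > 0, ∃ N, ∀ n ≥ N, ∀ z, ‖f z - (u n).fn z‖ ≤ ε * v.toFun z := by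
    intro ε hε
    obtain ⟨N, hN⟩ := key ε hε
    refine ⟨N, fun n hn z => le_of_tendsto ((hf z).sub_const _).norm ?_⟩
    filter_upwards [eventually_ge_atTop N] with m hm using hN m hm n hn z
  have hloc : TendstoLocallyUniformlyOn (fun n => zeroExtend (u n).fn) (zeroExtend f) atTop G := by
    refine Metric.tendstoLocallyUniformlyOn_iff.mpr fun ε hε x hx => ?_
    have hmem : {z : G | v.toFun z < v.toFun ⟨x, hx⟩ + 1} ∈ 𝓝 (⟨x, hx⟩ : G) :=
      v.continuous.continuousAt.eventually_lt_const (lt_add_one _)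
    have hv := v.pos ⟨x, hx⟩
    refine ⟨Subtype.val '' {z : G | v.toFun z < v.toFun ⟨x, hx⟩ + 1}, ?_, ?_⟩
    · have := image_mem_map (m := Subtype.val) hmem
      rwa [map_nhds_subtype_val] at this
    · obtain ⟨N, hN⟩ := key2 (ε / 2 / (v.toFun ⟨x, hx⟩ + 1)) (by positivity)
      filter_upwards [eventually_ge_atTop N] with n hn
      rintro _ ⟨z, hz, rfl⟩
      rw [zeroExtend_apply, zeroExtend_apply, dist_eq_norm]
      refine (hN n hn z).trans_lt ?_
      have h1 : ε / 2 / (v.toFun ⟨x, hx⟩ + 1) * v.toFun z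
          ≤ ε / 2 / (v.toFun ⟨x, hx⟩ + 1) * (v.toFun ⟨x, hx⟩ + 1) :=
        mul_le_mul_of_nonneg_left (le_of_lt hz) (by positivity)
      rw [div_mul_cancel₀ _ (by positivity)] at h1
      linarith
  have hdiff : DifferentiableOn ℂ (zeroExtend f) G :=
    hloc.differentiableOn (Eventually.of_forall fun n => (u n).differentiableOn) G.isOpen
  obtain ⟨N, hN⟩ := key2 1 one_pos
  have hbound : ∀ z : G, ‖zeroExtend f z‖ ≤ (1 + ‖u N‖) * v.toFun z := fun z => by
    rw [zeroExtend_apply]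
    have h1 := hN N le_rfl z
    have h2 := (u N).norm_fn_le z
    have h3 := norm_le_norm_sub_add (f z) ((u N).fn z)
    linarith
  refine ⟨ofBound (zeroExtend f) hdiff _ hbound, Metric.tendsto_atTop.mpr fun ε hε => ?_⟩
  obtain ⟨N, hN⟩ := key2 (ε / 2) (by positivity)
  refine ⟨N, fun n hn => ?_⟩
  rw [dist_comm, dist_eq_norm]
  refine (norm_le_of_forall _ (half_pos hε).le fun z => ?_).trans_lt (half_lt_self hε)
  rw [fn_sub, fn_ofBound, Pi.sub_apply, zeroExtend_apply]
  exact hN n hn z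

end WeightedSpace

/-! ### Right derivatives and tangents of a log-convex weight. -/

section RadialWeight

variable {v : ℝ → ℝ}

/-- A radial log-convex weight has a right derivative on `(0,1)`, and `x ↦ log v(eˣ)` lies above its
right tangents. -/
theorem IsLogConvexDisc.hasDerivWithinAt_and_tangent (hv : IsRadialDiscWeight v)
    (hlc : IsLogConvexDisc v) {r : ℝ} (hr : r ∈ Ioo (0 : ℝ) 1) :
    HasDerivWithinAt v (rightDeriv v r) (Ici r) r ∧ ∀ s ∈ Ioo (0 : ℝ) 1,
      Real.log (v r) + r * rightDeriv v r / v r * (Real.log s - Real.log r) ≤ Real.log (v s) := by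
  set φ : ℝ → ℝ := fun x => Real.log (v (Real.exp x)) with hφ
  set x := Real.log r with hx
  have hvr : 0 < v r := hv.pos r ⟨hr.1.le, hr.2⟩
  have hφe : ∀ s ∈ Ioo (0 : ℝ) 1, φ (Real.log s) = Real.log (v s) := fun s hs => by
    simp [hφ, Real.exp_log hs.1]
  have hneg : ∀ s ∈ Ioo (0 : ℝ) 1, Real.log s ∈ Iio (0 : ℝ) := fun s hs =>
    Real.log_neg hs.1 hs.2
  have hint : x ∈ interior (Iio (0 : ℝ)) := by
    rw [interior_Iio]; exact hneg r hr
  have hd := ConvexOn.hasDerivWithinAt_rightDeriv_of_mem_interior hlc hint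
  set p := derivWithin φ (Ioi x) x
  have hd' : HasDerivWithinAt φ p (Ici x) x := hd.Ici_of_Ioi
  have hcomp : HasDerivWithinAt (fun s => Real.exp (φ (Real.log s)))
      (Real.exp (φ (Real.log r)) * (p * r⁻¹)) (Ici r) r := by
    refine HasDerivWithinAt.exp ?_
    refine HasDerivWithinAt.comp (s' := Ici x) r hd' (Real.hasDerivAt_log hr.1.ne').hasDerivWithinAt ?_
    intro s hs
    exact Real.log_le_log hr.1 hs
  have hvd : HasDerivWithinAt v (v r * (p * r⁻¹)) (Ici r) r := by
    rw [hφe r hr, Real.exp_log hvr] at hcomp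
    refine hcomp.congr_of_eventuallyEq ?_ (by rw [hφe r hr, Real.exp_log hvr])
    filter_upwards [Ico_mem_nhdsGE hr.2] with s hs
    have hs' : s ∈ Ioo (0 : ℝ) 1 := ⟨hr.1.trans_le hs.1, hs.2⟩
    rw [hφe s hs', Real.exp_log (hv.pos s ⟨hs'.1.le, hs'.2⟩)]
  have hrd : rightDeriv v r = v r * (p * r⁻¹) := hvd.derivWithin (uniqueDiffOn_Ici r r self_mem_Ici)
  refine ⟨hrd ▸ hvd, fun s hs => ?_⟩
  have hp : r * rightDeriv v r / v r = p := by
    rw [hrd]; have := hr.1.ne'; field_simp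
  rw [hp, ← hφe r hr, ← hφe s hs]
  -- To the right of x the secant slope is at least the right derivative; to the left it is at most
  -- the left derivative, hence at most the right one.
  rcases lt_trichotomy x (Real.log s) with h | h | h
  · have h1 := ConvexOn.rightDeriv_le_slope_of_mem_interior hlc hint (hneg s hs) h
    rw [slope_def_field, le_div_iff₀ (sub_pos.mpr h)] at h1
    linarith
  · rw [← h, hx]; simp
  · have h1 := ConvexOn.slope_le_leftDeriv_of_mem_interior hlc (hneg s hs) hint h
    have h2 := ConvexOn.leftDeriv_le_rightDeriv_of_mem_interior hlc hint
    have h3 := h1.trans h2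
    rw [slope_def_field, div_le_iff₀ (sub_pos.mpr h)] at h3
    change φ x - φ (Real.log s) ≤ p * (x - Real.log s) at h3
    linarith

theorem IsRadialDiscWeight.rightDeriv_nonneg (hv : IsRadialDiscWeight v) {r : ℝ}
    (hr : r ∈ Ioo (0 : ℝ) 1) : 0 ≤ rightDeriv v r := by
  have h : derivWithin v (Ico r 1) r = rightDeriv v r :=
    derivWithin_congr_set (by
      filter_upwards [Iio_mem_nhds hr.2] with s hs
      exact propext ⟨fun h => h.1, fun h => ⟨h, hs⟩⟩)
  rw [← h]
  exact (hv.monotoneOn.mono (Ico_subset_Ico_left hr.1.le)).derivWithin_nonneg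

/-! ### Limit conditions as eventual real bounds. -/

theorem limsup_growthQuotient_lt_top_iff :
    limsup (growthQuotient v) (𝓝[<] 1) < ⊤ ↔
      ∃ M : ℝ, ∀ᶠ r in 𝓝[<] 1, (1 - r) * rightDeriv v r / v r ≤ M := by
  constructor
  · intro h
    obtain ⟨M, hM, -⟩ := EReal.lt_iff_exists_real_btwn.mp h
    refine ⟨M, (eventually_lt_of_limsup_lt hM).mono fun r hr => ?_⟩
    exact (EReal.coe_lt_coe_iff.mp hr).le
  · rintro ⟨M, hM⟩
    refine (limsup_le_of_le (a := (M : EReal)) (by isBoundedDefault)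
      (hM.mono fun r hr => ?_)).trans_lt (EReal.coe_lt_top M)
    exact EReal.coe_le_coe_iff.mpr hr

theorem liminf_growthQuotient_pos_iff :
    0 < liminf (growthQuotient v) (𝓝[<] 1) ↔
      ∃ c > (0 : ℝ), ∀ᶠ r in 𝓝[<] 1, c ≤ (1 - r) * rightDeriv v r / v r := by
  constructor
  · intro h
    obtain ⟨c, hc0, hc⟩ := EReal.lt_iff_exists_real_btwn.mp h
    refine ⟨c, EReal.coe_pos.mp hc0, (eventually_lt_of_lt_liminf hc).mono fun r hr => ?_⟩
    exact (EReal.coe_lt_coe_iff.mp hr).le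
  · rintro ⟨c, hc0, hc⟩
    refine (EReal.coe_pos.mpr hc0).trans_le (le_liminf_of_le (a := (c : EReal))
      (by isBoundedDefault) (hc.mono fun r hr => ?_))
    exact EReal.coe_le_coe_iff.mpr hr

theorem exists_forall_Ico_of_eventually_nhdsLT_one {P : ℝ → Prop} (h : ∀ᶠ r in 𝓝[<] (1 : ℝ), P r) :
    ∃ a ∈ Ioo (0 : ℝ) 1, ∀ r ∈ Ico a 1, P r := by
  obtain ⟨l, hl, hlP⟩ := mem_nhdsLT_iff_exists_Ioo_subset.mp h
  have hl : l < 1 := hl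
  refine ⟨max ((l + 1) / 2) (1 / 2), ⟨by positivity, max_lt (by linarith) (by norm_num)⟩,
    fun r hr => hlP ⟨?_, hr.2⟩⟩
  have := (le_max_left _ _).trans hr.1
  linarith

/-! ### Sufficiency: boundedness by Cauchy estimates, surjectivity by radial integration. -/

/-- A bound on `(1 - r) v'(r) / v(r)` makes `v` doubling at the boundary. -/
theorem IsRadialDiscWeight.exists_doubling (hv : IsRadialDiscWeight v) (hlc : IsLogConvexDisc v)
    (h : ∃ M : ℝ, ∀ᶠ r in 𝓝[<] 1, (1 - r) * rightDeriv v r / v r ≤ M) :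
    ∃ C, 0 ≤ C ∧ ∀ r ∈ Ico (0 : ℝ) 1, v ((1 + r) / 2) ≤ C * v r := by
  obtain ⟨M, hM⟩ := h
  obtain ⟨a, ha, hM⟩ := exists_forall_Ico_of_eventually_nhdsLT_one hM
  have hv0 := hv.pos 0 ⟨le_rfl, one_pos⟩
  have hb := hv.pos ((1 + a) / 2) ⟨by linarith [ha.1], by linarith [ha.2]⟩
  -- The exponential serves r ≥ a; the quotient serves r < a, by monotonicity alone.
  refine ⟨Real.exp (M / a) + v ((1 + a) / 2) / v 0, by positivity, fun r hr => ?_⟩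
  have hvr := hv.pos r hr
  rw [add_mul]
  rcases lt_or_ge r a with hra | hra
  · have h1 : v ((1 + r) / 2) ≤ v ((1 + a) / 2) :=
      hv.monotoneOn ⟨by linarith [hr.1], by linarith [hr.2]⟩ ⟨by linarith [ha.1], by linarith [ha.2]⟩
        (by linarith)
    have h2 : v 0 ≤ v r := hv.monotoneOn ⟨le_rfl, one_pos⟩ hr hr.1
    have h3 : v ((1 + a) / 2) ≤ v ((1 + a) / 2) / v 0 * v r := by
      rw [div_mul_eq_mul_div, le_div_iff₀ hv0]
      exact mul_le_mul_of_nonneg_left h2 hb.le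
    have h4 : 0 ≤ Real.exp (M / a) * v r := by positivity
    linarith
  · have hr0 : 0 < r := ha.1.trans_le hra
    set s := (1 + r) / 2 with hs
    have hs1 : s ∈ Ioo (0 : ℝ) 1 := ⟨by linarith, by linarith [hr.2]⟩
    have hvs := hv.pos s ⟨hs1.1.le, hs1.2⟩
    -- The tangent is taken at the midpoint s and evaluated back at r, which bounds v(s) from above
    -- by v(r).
    have ht := (hlc.hasDerivWithinAt_and_tangent hv hs1).2 r ⟨hr0, hr.2⟩
    have hq := hM s ⟨by linarith [hr.2], hs1.2⟩
    have hd := hv.rightDeriv_nonneg hs1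
    have hlog : Real.log s - Real.log r ≤ (1 - s) / r := by
      rw [← Real.log_div hs1.1.ne' hr0.ne']
      refine (Real.log_le_sub_one_of_pos (by have := hs1.1; positivity)).trans_eq ?_
      field_simp
      linarith
    have hp : 0 ≤ s * rightDeriv v s / v s := by have := hs1.1; positivity
    have hq0 : 0 ≤ (1 - s) * rightDeriv v s / v s := by
      have := sub_pos.mpr hs1.2; positivity
    have h1 : s * rightDeriv v s / v s * (Real.log s - Real.log r) ≤ M / a := by
      refine (mul_le_mul_of_nonneg_left hlog hp).trans ?_
      have h2 : s * rightDeriv v s / v s * ((1 - s) / r)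
          = s * ((1 - s) * rightDeriv v s / v s) / r := by ring
      rw [h2]
      refine div_le_div₀ (hq0.trans hq) ?_ ha.1 hra
      exact (mul_le_of_le_one_left hq0 hs1.2.le).trans hq
    have h2 : v s ≤ Real.exp (M / a) * v r := by
      rw [← Real.log_le_log_iff hvs (by positivity), Real.log_mul (Real.exp_ne_zero _) hvr.ne',
        Real.log_exp]
      linarith
    have h3 : 0 ≤ v ((1 + a) / 2) / v 0 * v r := by positivity
    linarith

/-- Cauchy's estimate on the circle of radius (1-r)/2 about z: it lies in |ζ| ≤ (1+r)/2, where
doubling controls v. -/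
theorem IsRadialDiscWeight.norm_complexDeriv_le (hv : IsRadialDiscWeight v) {C : ℝ}
    (hC : ∀ r ∈ Ico (0 : ℝ) 1, v ((1 + r) / 2) ≤ C * v r) (f : WeightedSpace hv.toWeight)
    (z : unitDisc) :
    ‖deriv (zeroExtend f.fn) z‖ ≤ 2 * C * ‖f‖ * hv.div_one_sub.toWeight.toFun z := by
  have hr := norm_mem_Ico_of_mem_unitDisc z
  change _ ≤ 2 * C * ‖f‖ * (v ‖(z : ℂ)‖ / (1 - ‖(z : ℂ)‖))
  set r := ‖(z : ℂ)‖ with hrdef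
  have hR : 0 < (1 - r) / 2 := by linarith [hr.2]
  have hle : ∀ ζ ∈ Metric.closedBall (z : ℂ) ((1 - r) / 2), ‖ζ‖ ≤ (1 + r) / 2 := fun ζ hζ => by
    have h1 : ‖ζ - z‖ ≤ (1 - r) / 2 := mem_closedBall_iff_norm.mp hζ
    have h2 := norm_le_norm_sub_add ζ z
    linarith
  have hsub : Metric.closedBall (z : ℂ) ((1 - r) / 2) ⊆ (unitDisc : Set ℂ) := fun ζ hζ =>
    mem_ball_zero_iff.mpr ((hle ζ hζ).trans_lt (by linarith [hr.2]))
  have h := Complex.norm_deriv_le_of_forall_mem_sphere_norm_le (C := ‖f‖ * (C * v r)) hR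
    (f.differentiableOn.diffContOnCl_ball hsub) fun ζ hζ => by
      have hζ' := Metric.sphere_subset_closedBall hζ
      have hm := hsub hζ'
      have h1 := f.norm_fn_le ⟨ζ, hm⟩
      rw [← zeroExtend_apply f.fn] at h1
      refine h1.trans (mul_le_mul_of_nonneg_left ((hv.monotoneOn
        (norm_mem_Ico_of_mem_unitDisc ⟨ζ, hm⟩) ⟨by linarith [hr.1], by linarith [hr.2]⟩
        (hle ζ hζ')).trans (hC r hr)) (norm_nonneg f))
  refine h.trans_eq ?_
  have : 1 - r ≠ 0 := by linarith
  field_simp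

theorem IsRadialDiscWeight.exists_diffCLM (hv : IsRadialDiscWeight v) {C : ℝ} (hC0 : 0 ≤ C)
    (hC : ∀ r ∈ Ico (0 : ℝ) 1, v ((1 + r) / 2) ≤ C * v r) :
    ∃ D : WeightedSpace hv.toWeight →L[ℂ] WeightedSpace hv.div_one_sub.toWeight,
      ∀ f, (D f).fn = complexDeriv f.fn := by
  have hda : ∀ (f : WeightedSpace hv.toWeight) (z : unitDisc),
      DifferentiableAt ℂ (zeroExtend f.fn) z := fun f z =>
    f.differentiableOn.differentiableAt (unitDisc.isOpen.mem_nhds z.2)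
  let L : WeightedSpace hv.toWeight →ₗ[ℂ] WeightedSpace hv.div_one_sub.toWeight :=
    { toFun := fun f => WeightedSpace.ofBound (deriv (zeroExtend f.fn))
        (f.differentiableOn.deriv unitDisc.isOpen) (2 * C * ‖f‖) (hv.norm_complexDeriv_le hC f)
      map_add' := fun f g => WeightedSpace.fn_injective <| funext fun z => by
        change deriv (zeroExtend (f.fn + g.fn)) z = _
        rw [zeroExtend_add]
        exact deriv_add (hda f z) (hda g z)
      map_smul' := fun c f => WeightedSpace.fn_injective <| funext fun z => by
        change deriv (zeroExtend (c • f.fn)) z = _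
        rw [zeroExtend_smul]
        exact deriv_const_smul c (hda f z) }
  exact ⟨L.mkContinuous (2 * C) fun f => WeightedSpace.norm_le_of_forall _ (by positivity)
    (hv.norm_complexDeriv_le hC f), fun f => rfl⟩

/-- A positive lower bound on `(1 - r) v'(r) / v(r)` lets every `g ∈ H_w` be integrated in `H_v`. -/
theorem IsRadialDiscWeight.exists_primitive (hv : IsRadialDiscWeight v) (hlc : IsLogConvexDisc v)
    (h : ∃ c > (0 : ℝ), ∀ᶠ r in 𝓝[<] 1, c ≤ (1 - r) * rightDeriv v r / v r)
    (g : WeightedSpace hv.div_one_sub.toWeight) :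
    ∃ f : WeightedSpace hv.toWeight, complexDeriv f.fn = g.fn := by
  obtain ⟨c, hc0, hc⟩ := h
  obtain ⟨a, ha, hc⟩ := exists_forall_Ico_of_eventually_nhdsLT_one hc
  obtain ⟨F, hF⟩ : Complex.IsExactOn (zeroExtend g.fn) (Metric.ball 0 1) :=
    DifferentiableOn.isExactOn_ball g.differentiableOn
  have hFd : DifferentiableOn ℂ F (Metric.ball 0 1) := fun z hz =>
    (hF z hz).differentiableAt.differentiableWithinAt
  have hcb : Metric.closedBall (0 : ℂ) a ⊆ Metric.ball 0 1 :=
    Metric.closedBall_subset_ball ha.2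
  obtain ⟨A, hA⟩ := (isCompact_closedBall (0 : ℂ) a).exists_bound_of_continuousOn
    (hFd.continuousOn.mono hcb)
  have hA0 : 0 ≤ A := (norm_nonneg _).trans (hA 0 (Metric.mem_closedBall_self ha.1.le))
  have hv0 := hv.pos 0 ⟨le_rfl, one_pos⟩
  -- With this K, |g| ≤ ‖g‖ v/(1-r) ≤ K v' on a ≤ |z| < 1.
  set K := ‖g‖ / c with hK
  have hK0 : 0 ≤ K := by positivity
  have key : ∀ z ∈ Metric.ball (0 : ℂ) 1, ‖F z‖ ≤ A + K * v ‖z‖ := by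
    intro z hz
    have hz1 : ‖z‖ < 1 := mem_ball_zero_iff.mp hz
    have hvz := hv.pos ‖z‖ ⟨norm_nonneg z, hz1⟩
    rcases le_or_gt ‖z‖ a with hza | hza
    · have := hA z (mem_closedBall_zero_iff.mpr hza)
      have : 0 ≤ K * v ‖z‖ := by positivity
      linarith
    have hz0 : 0 < ‖z‖ := ha.1.trans hza
    set u : ℂ := z / ‖z‖ with hu
    have hun : ‖u‖ = 1 := by
      rw [hu, norm_div, Complex.norm_real, norm_norm, div_self hz0.ne']
    have hnorm : ∀ t : ℝ, 0 ≤ t → ‖(t : ℂ) * u‖ = t := fun t ht => by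
      rw [norm_mul, hun, mul_one, Complex.norm_real, Real.norm_of_nonneg ht]
    have hmem : ∀ t ∈ Icc a ‖z‖, (t : ℂ) * u ∈ Metric.ball (0 : ℂ) 1 := fun t ht => by
      rw [mem_ball_zero_iff, hnorm t (ha.1.le.trans ht.1)]
      exact ht.2.trans_lt hz1
    have hder : ∀ t ∈ Icc a ‖z‖, HasDerivAt (fun t : ℝ => F (t * u))
        (zeroExtend g.fn (t * u) * u) t := fun t ht => by
      have h1 : HasDerivAt (fun w : ℂ => F (w * u)) (zeroExtend g.fn (t * u) * (1 * u)) (t : ℂ) :=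
        HasDerivAt.comp (t : ℂ) (hF _ (hmem t ht)) ((hasDerivAt_id (t : ℂ)).mul_const u)
      rw [one_mul] at h1
      exact h1.comp_ofReal
    -- This mean value inequality requires only a right derivative of the majorant A + Kv.
    have hfin := image_norm_le_of_norm_deriv_right_le_deriv_boundary'
      (f := fun t : ℝ => F (t * u)) (f' := fun t => zeroExtend g.fn (t * u) * u)
      (a := a) (b := ‖z‖) (B := fun t => A + K * v t) (B' := fun t => K * rightDeriv v t)
      (fun t ht => (hder t ht).continuousAt.continuousWithinAt)
      (fun t ht => (hder t (Ico_subset_Icc_self ht)).hasDerivWithinAt)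
      (by
        have h1 : ‖F (a * u)‖ ≤ A := hA _ (mem_closedBall_zero_iff.mpr (hnorm a ha.1.le).le)
        have h2 := hv.pos a ⟨ha.1.le, ha.2⟩
        have h3 : 0 ≤ K * v a := by positivity
        exact h1.trans (by linarith))
      (continuousOn_const.add (continuousOn_const.mul (hv.continuousOn.mono
        fun t ht => ⟨ha.1.le.trans ht.1, ht.2.trans_lt hz1⟩)))
      (fun t ht => ((hlc.hasDerivWithinAt_and_tangent hv
        ⟨ha.1.trans_le ht.1, ht.2.trans hz1⟩).1.const_mul K).const_add A)
      (fun t ht => by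
        have ht1 : t < 1 := ht.2.trans hz1
        have ht0 : 0 ≤ t := ha.1.le.trans ht.1
        have hvt := hv.pos t ⟨ht0, ht1⟩
        have h1 := g.norm_fn_le ⟨t * u, hmem t (Ico_subset_Icc_self ht)⟩
        rw [← zeroExtend_apply g.fn] at h1
        change _ ≤ ‖g‖ * (v ‖(t : ℂ) * u‖ / (1 - ‖(t : ℂ) * u‖)) at h1
        rw [hnorm t ht0] at h1
        rw [norm_mul, hun, mul_one]
        refine h1.trans ?_
        rw [hK, div_mul_eq_mul_div, mul_div_assoc]
        refine mul_le_mul_of_nonneg_left ?_ (norm_nonneg g)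
        have h2 := hc t ⟨ht.1, ht1⟩
        rw [le_div_iff₀ hvt] at h2
        rw [div_le_div_iff₀ (sub_pos.mpr ht1) hc0]
        linarith)
      (right_mem_Icc.mpr hza.le)
    have huz : ((‖z‖ : ℝ) : ℂ) * u = z := by
      rw [hu, mul_div_cancel₀]
      exact_mod_cast hz0.ne'
    simpa only [huz] using hfin
  refine ⟨WeightedSpace.ofBound F hFd (A / v 0 + K) fun z => ?_, ?_⟩
  · have h1 := key z z.2
    have h2 : v 0 ≤ v ‖(z : ℂ)‖ := hv.monotoneOn ⟨le_rfl, one_pos⟩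
      (norm_mem_Ico_of_mem_unitDisc z) (norm_nonneg _)
    have h3 : A ≤ A / v 0 * v ‖(z : ℂ)‖ := by
      rw [div_mul_eq_mul_div, le_div_iff₀ hv0]
      exact mul_le_mul_of_nonneg_left h2 hA0
    change _ ≤ (A / v 0 + K) * v ‖(z : ℂ)‖
    linarith
  · change complexDeriv (fun z : unitDisc => F z) = g.fn
    rw [complexDeriv_restrict]
    funext z
    rw [(hF z z.2).deriv, zeroExtend_apply]

/-! ### Necessity of the upper bound: monomials. -/

/-- The tangent at log r has slope at least n, so beyond r the quotient sⁿ/v(s) never exceeds its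
value at r; its maximum can be sought on [0,r]. -/
theorem IsLogConvexDisc.pow_mul_le_pow_mul (hv : IsRadialDiscWeight v) (hlc : IsLogConvexDisc v)
    {r s : ℝ} (hr : r ∈ Ioo (0 : ℝ) 1) (hs : s ∈ Ico r 1) {n : ℕ}
    (hn : (n : ℝ) ≤ r * rightDeriv v r / v r) : s ^ n * v r ≤ r ^ n * v s := by
  have hs0 : 0 < s := hr.1.trans_le hs.1
  have hr0 := hr.1
  have hvr := hv.pos r ⟨hr.1.le, hr.2⟩
  have hvs := hv.pos s ⟨hs0.le, hs.2⟩
  have ht := (hlc.hasDerivWithinAt_and_tangent hv hr).2 s ⟨hs0, hs.2⟩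
  have hl : 0 ≤ Real.log s - Real.log r := sub_nonneg.mpr (Real.log_le_log hr.1 hs.1)
  have h1 := mul_le_mul_of_nonneg_right hn hl
  rw [← Real.log_le_log_iff (by positivity) (by positivity),
    Real.log_mul (by positivity) hvr.ne', Real.log_mul (by positivity) hvs.ne', Real.log_pow,
    Real.log_pow]
  linarith

/-- In the tangent inequality -p(r) log r ≥ 0 can be dropped, and log s ≤ 0 allows p(r) to be
replaced by the larger n. -/
theorem IsLogConvexDisc.mul_pow_le (hv : IsRadialDiscWeight v) (hlc : IsLogConvexDisc v)
    {r s : ℝ} (hr : r ∈ Ioo (0 : ℝ) 1) (hs : s ∈ Ico (0 : ℝ) 1) {n : ℕ} (hn0 : n ≠ 0)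
    (hn : r * rightDeriv v r / v r ≤ n) : v r * s ^ n ≤ v s := by
  have hvs := hv.pos s hs
  rcases hs.1.eq_or_lt with rfl | hs0
  · simpa [hn0] using hvs.le
  have hr0 := hr.1
  have hvr := hv.pos r ⟨hr.1.le, hr.2⟩
  have ht := (hlc.hasDerivWithinAt_and_tangent hv hr).2 s ⟨hs0, hs.2⟩
  have hd := hv.rightDeriv_nonneg hr
  have hp : 0 ≤ r * rightDeriv v r / v r := by positivity
  have h1 := mul_le_mul_of_nonpos_right hn (Real.log_neg hs0 hs.2).le
  have h2 := mul_nonpos_of_nonneg_of_nonpos hp (Real.log_neg hr.1 hr.2).le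
  rw [← Real.log_le_log_iff (by positivity) hvs, Real.log_mul hvr.ne' (by positivity), Real.log_pow]
  linarith

/-- Testing the boundedness of `D` on the monomial `zⁿ`, at the point where `zⁿ` attains its norm. -/
theorem IsRadialDiscWeight.natCast_mul_le_norm (hv : IsRadialDiscWeight v) (hlc : IsLogConvexDisc v)
    (D : WeightedSpace hv.toWeight →L[ℂ] WeightedSpace hv.div_one_sub.toWeight)
    (hD : ∀ f, (D f).fn = complexDeriv f.fn) {r : ℝ} (hr : r ∈ Ioo (0 : ℝ) 1) {n : ℕ}
    (hn : (n : ℝ) ≤ r * rightDeriv v r / v r) : n * (1 - r) ≤ ‖D‖ := by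
  rcases Nat.eq_zero_or_pos n with rfl | hn0
  · simp
  have hsub : Icc 0 r ⊆ Ico (0 : ℝ) 1 := fun s hs => ⟨hs.1, hs.2.trans_lt hr.2⟩
  have hvr := hv.pos r ⟨hr.1.le, hr.2⟩
  have hcont : ContinuousOn (fun s => s ^ n / v s) (Icc 0 r) :=
    (continuousOn_pow n).div (hv.continuousOn.mono hsub) fun s hs => (hv.pos s (hsub hs)).ne'
  obtain ⟨s, hs, hmax⟩ := isCompact_Icc.exists_isMaxOn (nonempty_Icc.mpr hr.1.le) hcont
  have hs1 := hsub hs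
  have hvs := hv.pos s hs1
  have hmax' : ∀ t ∈ Ico (0 : ℝ) 1, t ^ n / v t ≤ s ^ n / v s := by
    intro t ht
    rcases le_or_gt t r with htr | htr
    · exact hmax ⟨ht.1, htr⟩
    · refine le_trans ?_ (hmax (right_mem_Icc.mpr hr.1.le))
      change _ ≤ r ^ n / v r
      rw [div_le_div_iff₀ (hv.pos t ht) hvr]
      exact hlc.pow_mul_le_pow_mul hv hr ⟨htr.le, ht.2⟩ hn
  -- The maximum is positive, whereas 0ⁿ = 0 for n > 0.
  have hs0 : 0 < s := by
    have h1 := hmax' r ⟨hr.1.le, hr.2⟩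
    have h2 : 0 < r ^ n / v r := by have := hr.1; positivity
    refine hs.1.lt_of_ne fun h => ?_
    rw [← h, zero_pow hn0.ne', zero_div] at h1
    linarith
  have hb : ∀ z : unitDisc, ‖(fun z : ℂ => z ^ n) z‖ ≤ s ^ n / v s * hv.toWeight.toFun z := by
    intro z
    have hz := norm_mem_Ico_of_mem_unitDisc z
    rw [norm_pow]
    exact (div_le_iff₀ (hv.pos _ hz)).mp (hmax' _ hz)
  let f : WeightedSpace hv.toWeight := WeightedSpace.ofBound (fun z => z ^ n)
    (differentiable_pow n).differentiableOn _ hb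
  have hf : ‖f‖ ≤ s ^ n / v s := f.norm_le_of_forall (by positivity) hb
  have hsn : ‖(s : ℂ)‖ = s := by rw [Complex.norm_real, Real.norm_of_nonneg hs0.le]
  have hsm : (s : ℂ) ∈ unitDisc := mem_ball_zero_iff.mpr (hsn.trans_lt hs1.2)
  have h1 := (D f).norm_fn_le ⟨s, hsm⟩
  have h2 : (D f).fn ⟨s, hsm⟩ = n * (s : ℂ) ^ (n - 1) := by
    rw [hD]
    refine (congrFun (complexDeriv_restrict fun z : ℂ => z ^ n) ⟨s, hsm⟩).trans ?_
    simp
  rw [h2, norm_mul, norm_pow, hsn, Complex.norm_natCast] at h1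
  change _ ≤ _ * (v ‖(s : ℂ)‖ / (1 - ‖(s : ℂ)‖)) at h1
  rw [hsn] at h1
  have h1s : 0 < 1 - s := sub_pos.mpr hs1.2
  have h3 : n * s ^ (n - 1) ≤ ‖D‖ * (s ^ n / v s) * (v s / (1 - s)) :=
    h1.trans (mul_le_mul_of_nonneg_right ((D.le_opNorm f).trans
      (mul_le_mul_of_nonneg_left hf (norm_nonneg D))) (by positivity))
  have h4 : ‖D‖ * (s ^ n / v s) * (v s / (1 - s)) = ‖D‖ * s * s ^ (n - 1) / (1 - s) := by
    obtain ⟨m, rfl⟩ := Nat.exists_eq_succ_of_ne_zero hn0.ne'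
    simp only [Nat.succ_eq_add_one, Nat.add_sub_cancel, pow_succ]
    field_simp
  rw [h4, le_div_iff₀ h1s] at h3
  have h5 : n * (1 - s) ≤ ‖D‖ * s := by
    refine le_of_mul_le_mul_right ?_ (pow_pos hs0 (n - 1))
    linarith
  calc (n : ℝ) * (1 - r) ≤ n * (1 - s) := by gcongr; exact hs.2
    _ ≤ ‖D‖ * s := h5
    _ ≤ ‖D‖ := mul_le_of_le_one_right (norm_nonneg D) hs1.2.le

theorem IsRadialDiscWeight.eventually_growth_le (hv : IsRadialDiscWeight v)
    (hlc : IsLogConvexDisc v)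
    (D : WeightedSpace hv.toWeight →L[ℂ] WeightedSpace hv.div_one_sub.toWeight)
    (hD : ∀ f, (D f).fn = complexDeriv f.fn) :
    ∃ M : ℝ, ∀ᶠ r in 𝓝[<] 1, (1 - r) * rightDeriv v r / v r ≤ M := by
  -- The 1 pays for the floor of p(r), the factor 2 for dividing by r > 1/2.
  refine ⟨2 * (‖D‖ + 1), ?_⟩
  filter_upwards [Ioo_mem_nhdsLT (show (1 / 2 : ℝ) < 1 by norm_num)] with r hr
  have hr0 : 0 < r := by linarith [hr.1]
  have hr' : r ∈ Ioo (0 : ℝ) 1 := ⟨hr0, hr.2⟩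
  have hvr := hv.pos r ⟨hr0.le, hr.2⟩
  have hd := hv.rightDeriv_nonneg hr'
  have hp : 0 ≤ r * rightDeriv v r / v r := by positivity
  have h1 := hv.natCast_mul_le_norm hlc D hD hr' (Nat.floor_le hp)
  have h2 := (Nat.lt_floor_add_one (r * rightDeriv v r / v r)).le
  have h1r : 0 < 1 - r := sub_pos.mpr hr.2
  have h3 := mul_le_mul_of_nonneg_right h2 h1r.le
  have h4 : r * ((1 - r) * rightDeriv v r / v r) = r * rightDeriv v r / v r * (1 - r) := by ring
  have h5 : 0 ≤ (1 - r) * rightDeriv v r / v r := by positivity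
  nlinarith [hr.1]

/-! ### Necessity of the lower bound: lacunary polynomials. -/

theorem natCast_mul_one_sub_mul_pow_le {r : ℝ} (hr : r ∈ Ico (0 : ℝ) 1) (n : ℕ) :
    n * (1 - r) * r ^ n ≤ 1 - r ^ n := by
  have h : (n : ℝ) * r ^ n ≤ ∑ k ∈ Finset.range n, r ^ k := by
    have := Finset.card_nsmul_le_sum (Finset.range n) (fun k => r ^ k) (r ^ n) fun k hk =>
      pow_le_pow_of_le_one hr.1 hr.2.le (Finset.mem_range.mp hk).le
    simpa using this
  rw [← mul_neg_geom_sum]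
  calc n * (1 - r) * r ^ n = (1 - r) * (n * r ^ n) := by ring
    _ ≤ _ := mul_le_mul_of_nonneg_left h (sub_nonneg.mpr hr.2.le)

/-- With m = 2^(N+i), each term is at most r^m - r^(2m); doubling the exponents makes these
differences telescope, so the bound does not depend on J. -/
theorem lacunary_sum_le {r : ℝ} (hr : r ∈ Ico (0 : ℝ) 1) (N J : ℕ) :
    ∑ i ∈ Finset.range J, (2 : ℝ) ^ (N + i) * (1 - r) * r ^ (2 * 2 ^ (N + i)) ≤ 1 := by
  have h : ∀ i ∈ Finset.range J, (2 : ℝ) ^ (N + i) * (1 - r) * r ^ (2 * 2 ^ (N + i)) ≤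
      r ^ 2 ^ (N + i) - r ^ 2 ^ (N + (i + 1)) := by
    intro i _
    have h1 := mul_le_mul_of_nonneg_right (natCast_mul_one_sub_mul_pow_le hr (2 ^ (N + i)))
      (pow_nonneg hr.1 (2 ^ (N + i)))
    push_cast at h1
    have h2 : r ^ 2 ^ (N + (i + 1)) = r ^ 2 ^ (N + i) * r ^ 2 ^ (N + i) := by
      rw [← pow_add]; congr 1; ring
    have h3 : r ^ (2 * 2 ^ (N + i)) = r ^ 2 ^ (N + i) * r ^ 2 ^ (N + i) := by
      rw [← pow_add]; congr 1; ring
    rw [h2, h3]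
    linarith
  refine (Finset.sum_le_sum h).trans ?_
  rw [Finset.sum_range_sub' (fun i => r ^ 2 ^ (N + i))]
  have h1 : r ^ 2 ^ (N + 0) ≤ 1 := pow_le_one₀ hr.1 hr.2.le
  have h2 : 0 ≤ r ^ 2 ^ (N + J) := pow_nonneg hr.1 _
  linarith

/-- Testing an inverse estimate for `D` on the derivative of a lacunary polynomial. -/
theorem IsRadialDiscWeight.lacunary_sum_le_of_preimage (hv : IsRadialDiscWeight v)
    (hlc : IsLogConvexDisc v)
    (D : WeightedSpace hv.toWeight →L[ℂ] WeightedSpace hv.div_one_sub.toWeight)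
    (hD : ∀ f, (D f).fn = complexDeriv f.fn) {C : ℝ} (hC0 : 0 < C)
    (hC : ∀ y, ∃ x, D x = y ∧ ‖x‖ ≤ C * ‖y‖) {r : ℝ} (hr : r ∈ Ioo (0 : ℝ) 1) {N : ℕ}
    (hN : r * rightDeriv v r / v r ≤ 2 ^ N) (J : ℕ) :
    ∑ i ∈ Finset.range J, r ^ (4 * 2 ^ (N + i)) ≤ 8 * C := by
  have hr' : r ∈ Ico (0 : ℝ) 1 := ⟨hr.1.le, hr.2⟩
  have hvr := hv.pos r hr'
  let F : ℂ → ℂ := fun z => v r * ∑ i ∈ Finset.range J, z ^ (4 * 2 ^ (N + i))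
  let F' : ℂ → ℂ := fun z =>
    v r * ∑ i ∈ Finset.range J, ((4 * 2 ^ (N + i) : ℕ) : ℂ) * z ^ (4 * 2 ^ (N + i) - 1)
  have hF : ∀ z, HasDerivAt F (F' z) z := fun z =>
    (HasDerivAt.fun_sum fun i _ => hasDerivAt_pow (4 * 2 ^ (N + i)) z).const_mul _
  have hF'd : Differentiable ℂ F' := by
    have : Differentiable ℂ F := fun z => (hF z).differentiableAt
    have h2 : deriv F = F' := funext fun z => (hF z).deriv
    rw [← h2]
    exact this.contDiff (n := 2) |>.differentiable_deriv_two
  have hb : ∀ z : unitDisc, ‖F' z‖ ≤ 4 * hv.div_one_sub.toWeight.toFun z := by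
    intro z
    have hz := norm_mem_Ico_of_mem_unitDisc z
    change _ ≤ 4 * (v ‖(z : ℂ)‖ / (1 - ‖(z : ℂ)‖))
    have h0 : ‖F' z‖ ≤ v r * ∑ i ∈ Finset.range J,
        (4 * 2 ^ (N + i)) * ‖(z : ℂ)‖ ^ (4 * 2 ^ (N + i) - 1) := by
      simp only [F']
      rw [norm_mul, Complex.norm_real, Real.norm_of_nonneg hvr.le]
      refine mul_le_mul_of_nonneg_left ((norm_sum_le _ _).trans_eq
        (Finset.sum_congr rfl fun i _ => ?_)) hvr.le
      rw [norm_mul, norm_pow, Complex.norm_natCast]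
      push_cast
      rfl
    set s := ‖(z : ℂ)‖ with hs
    have h1s : 0 < 1 - s := sub_pos.mpr hz.2
    have hvs := hv.pos s hz
    rw [← mul_div_assoc, le_div_iff₀ h1s]
    refine (mul_le_mul_of_nonneg_right h0 h1s.le).trans ?_
    have h1 : ∀ i ∈ Finset.range J, v r * (4 * 2 ^ (N + i) * s ^ (4 * 2 ^ (N + i) - 1)) * (1 - s) ≤
        4 * v s * (2 ^ (N + i) * (1 - s) * s ^ (2 * 2 ^ (N + i))) := by
      intro i _
      -- The factor 4 in the exponents leaves room, even after differentiation, for 2^N powers that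
      -- turn v(r) into v(s) and 2·2^(N+i) powers for the telescoping sum.
      have hexp : 2 ^ N + 2 * 2 ^ (N + i) ≤ 4 * 2 ^ (N + i) - 1 := by
        have e1 : 2 ^ N ≤ 2 ^ (N + i) := Nat.pow_le_pow_right two_pos (by omega)
        have e2 : 1 ≤ 2 ^ (N + i) := Nat.one_le_two_pow
        omega
      have e3 : v r * s ^ (4 * 2 ^ (N + i) - 1) ≤ v s * s ^ (2 * 2 ^ (N + i)) := by
        calc v r * s ^ (4 * 2 ^ (N + i) - 1) ≤ v r * s ^ (2 ^ N + 2 * 2 ^ (N + i)) :=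
              mul_le_mul_of_nonneg_left (pow_le_pow_of_le_one hz.1 hz.2.le hexp) hvr.le
          _ = v r * s ^ 2 ^ N * s ^ (2 * 2 ^ (N + i)) := by rw [pow_add, mul_assoc]
          _ ≤ _ := mul_le_mul_of_nonneg_right (hlc.mul_pow_le hv hr hz (by positivity)
              (by exact_mod_cast hN)) (pow_nonneg hz.1 _)
      have e4 : (0 : ℝ) ≤ 4 * 2 ^ (N + i) * (1 - s) := by positivity
      have e5 := mul_le_mul_of_nonneg_left e3 e4
      linarith
    rw [Finset.mul_sum, Finset.sum_mul]
    refine (Finset.sum_le_sum h1).trans ?_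
    rw [← Finset.mul_sum]
    exact mul_le_of_le_one_right (by positivity) (lacunary_sum_le hz N J)
  let y : WeightedSpace hv.div_one_sub.toWeight :=
    WeightedSpace.ofBound F' hF'd.differentiableOn 4 hb
  have hy : ‖y‖ ≤ 4 := y.norm_le_of_forall (by norm_num) hb
  obtain ⟨x, hxy, hx⟩ := hC y
  have hx4 : ‖x‖ ≤ 4 * C := hx.trans (by nlinarith)
  have hxd : EqOn (deriv (zeroExtend x.fn)) (deriv F) (unitDisc : Set ℂ) := by
    intro z hz
    have h1 : complexDeriv x.fn ⟨z, hz⟩ = y.fn ⟨z, hz⟩ := by rw [← hD, hxy]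
    rw [(hF z).deriv]
    exact h1
  -- The preimage is F + a with a its value at 0. The values at 0 and r each cost at most 4C v(r),
  -- whence 8C.
  obtain ⟨a, ha⟩ := unitDisc.isOpen.exists_eq_add_of_deriv_eq
    (Metric.isPreconnected_ball (x := (0 : ℂ)) (r := 1)) x.differentiableOn
    (fun z _ => (hF z).differentiableAt.differentiableWithinAt) hxd
  have h0m : (0 : ℂ) ∈ unitDisc := Metric.mem_ball_self one_pos
  have hrn : ‖(r : ℂ)‖ = r := by rw [Complex.norm_real, Real.norm_of_nonneg hr.1.le]
  have hrm : (r : ℂ) ∈ unitDisc := mem_ball_zero_iff.mpr (hrn.trans_lt hr.2)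
  have hF0 : F 0 = 0 := by simp [F]
  have hFr : F r = ((v r * ∑ i ∈ Finset.range J, r ^ (4 * 2 ^ (N + i)) : ℝ) : ℂ) := by
    simp [F]
  have e0 : x.fn ⟨0, h0m⟩ = a := by
    rw [← zeroExtend_apply x.fn]; simpa [hF0] using ha h0m
  have er : x.fn ⟨r, hrm⟩ = F r + a := by
    rw [← zeroExtend_apply x.fn]; exact ha hrm
  have n0 := x.norm_fn_le ⟨0, h0m⟩
  have nr := x.norm_fn_le ⟨r, hrm⟩
  change _ ≤ ‖x‖ * v ‖(0 : ℂ)‖ at n0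
  change _ ≤ ‖x‖ * v ‖(r : ℂ)‖ at nr
  rw [norm_zero, e0] at n0
  rw [hrn, er] at nr
  have hv0 : v 0 ≤ v r := hv.monotoneOn ⟨le_rfl, one_pos⟩ hr' hr.1.le
  have h1 : ‖F r‖ ≤ ‖F r + a‖ + ‖a‖ := by
    have := norm_sub_le (F r + a) a
    rwa [add_sub_cancel_right] at this
  have h2 : ‖x‖ * v 0 ≤ ‖x‖ * v r := mul_le_mul_of_nonneg_left hv0 (norm_nonneg x)
  have h3 : ‖x‖ * v r ≤ 4 * C * v r := mul_le_mul_of_nonneg_right hx4 hvr.le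
  have h4 : v r * ∑ i ∈ Finset.range J, r ^ (4 * 2 ^ (N + i)) ≤ ‖F r‖ := by
    rw [hFr, Complex.norm_real]
    exact Real.le_norm_self _
  refine le_of_mul_le_mul_left ?_ hvr
  linarith

theorem IsRadialDiscWeight.eventually_le_growth (hv : IsRadialDiscWeight v)
    (hlc : IsLogConvexDisc v)
    (D : WeightedSpace hv.toWeight →L[ℂ] WeightedSpace hv.div_one_sub.toWeight)
    (hD : ∀ f, (D f).fn = complexDeriv f.fn) (hsurj : Function.Surjective D) :
    ∃ c > (0 : ℝ), ∀ᶠ r in 𝓝[<] 1, c ≤ (1 - r) * rightDeriv v r / v r := by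
  obtain ⟨C, hC0, hC⟩ := D.exists_preimage_norm_le hsurj
  -- J terms of size at least 1/2 then exceed the bound 8C; c is chosen so that all J terms are that
  -- large.
  obtain ⟨J, hJ⟩ := exists_nat_gt (16 * C)
  set c : ℝ := 1 / (16 * 2 ^ J) with hc
  have hc0 : 0 < c := by positivity
  refine ⟨c, hc0, ?_⟩
  filter_upwards [Ioo_mem_nhdsLT (show max 0 (1 - c) < (1 : ℝ) from max_lt one_pos (by linarith))]
    with r hr
  by_contra! hq
  have hr' : r ∈ Ioo (0 : ℝ) 1 := ⟨(le_max_left _ _).trans_lt hr.1, hr.2⟩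
  have hrc : 1 - r ≤ c := by linarith [(le_max_right _ _).trans_lt hr.1]
  have hvr := hv.pos r ⟨hr'.1.le, hr'.2⟩
  have hd := hv.rightDeriv_nonneg hr'
  have h1r : 0 < 1 - r := sub_pos.mpr hr.2
  set p := r * rightDeriv v r / v r with hp
  have hpc : p * (1 - r) ≤ c := by
    have h1 : p * (1 - r) = r * ((1 - r) * rightDeriv v r / v r) := by rw [hp]; ring
    have h2 : 0 ≤ (1 - r) * rightDeriv v r / v r := by positivity
    rw [h1]
    exact (mul_le_of_le_one_left h2 hr.2.le).trans hq.le
  -- The maximum with 1 makes a dyadic bracket available when p < 1; its extra cost is covered by 1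
  -- - r ≤ c. The exponent used below is N + 1.
  obtain ⟨N, hN1, hN2⟩ := exists_nat_pow_near (le_max_right p 1) one_lt_two
  have hNc : (2 : ℝ) ^ (N + 1) * (1 - r) ≤ 2 * c := by
    have h1 : max p 1 * (1 - r) ≤ c := by
      rcases max_cases p 1 with h | h <;> rw [h.1] <;> linarith
    have h2 := mul_le_mul_of_nonneg_right hN1 h1r.le
    rw [pow_succ]
    linarith
  have hsum := hv.lacunary_sum_le_of_preimage hlc D hD hC0 hC hr' ((le_max_left p 1).trans hN2.le) J
  have hterm : ∀ i ∈ Finset.range J, (1 / 2 : ℝ) ≤ r ^ (4 * 2 ^ (N + 1 + i)) := by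
    intro i hi
    -- Bernoulli: r^k ≥ 1 - k(1-r), where k(1-r) ≤ 4 · 1/8 by the choice of c.
    have hB := one_add_mul_le_pow (a := r - 1) (by linarith [hr'.1]) (4 * 2 ^ (N + 1 + i))
    rw [add_sub_cancel] at hB
    refine le_trans ?_ hB
    push_cast
    have h1 : (2 : ℝ) ^ i ≤ 2 ^ J :=
      pow_le_pow_right₀ one_le_two (Finset.mem_range.mp hi).le
    have h2 : (2 : ℝ) ^ (N + 1 + i) * (1 - r) ≤ 2 ^ J * (2 * c) := by
      rw [pow_add _ (N + 1) i, mul_comm ((2 : ℝ) ^ (N + 1)), mul_assoc]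
      exact mul_le_mul h1 hNc (by positivity) (by positivity)
    have h3 : (2 : ℝ) ^ J * (2 * c) = 1 / 8 := by
      rw [hc]; field_simp; norm_num
    linarith
  have hlow := Finset.card_nsmul_le_sum _ _ _ hterm
  rw [Finset.card_range, nsmul_eq_mul] at hlow
  linarith

end RadialWeight

theorem mainTheorem5 (v : ℝ → ℝ) (hv : IsRadialDiscWeight v) (hlc : IsLogConvexDisc v) :
    DiffIsEpimorphism hv.toWeight hv.div_one_sub.toWeight ↔
      0 < liminf (growthQuotient v) (𝓝[<] 1) ∧
        liminf (growthQuotient v) (𝓝[<] 1) ≤ limsup (growthQuotient v) (𝓝[<] 1) ∧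
        limsup (growthQuotient v) (𝓝[<] 1) < ⊤ := by
  constructor
  · rintro ⟨D, hD, hsurj⟩
    exact ⟨liminf_growthQuotient_pos_iff.mpr (hv.eventually_le_growth hlc D hD hsurj),
      liminf_le_limsup, limsup_growthQuotient_lt_top_iff.mpr (hv.eventually_growth_le hlc D hD)⟩
  · rintro ⟨hinf, -, hsup⟩
    obtain ⟨C, hC0, hC⟩ := hv.exists_doubling hlc (limsup_growthQuotient_lt_top_iff.mp hsup)
    obtain ⟨D, hD⟩ := hv.exists_diffCLM hC0 hC
    refine ⟨D, hD, fun g => ?_⟩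
    obtain ⟨f, hf⟩ := hv.exists_primitive hlc (liminf_growthQuotient_pos_iff.mp hinf) g
    exact ⟨f, WeightedSpace.fn_injective ((hD f).trans hf)⟩
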